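/- Let $R$ be a semiprimary ring, i.e. an associative unital ring whose Jacobson radical $\operatorname{rad}(R)$ is nilpotent and for which $R/\operatorname{rad}(R)$ is a semisimple ring. A class $\mathscr{C}$ of right $R$-modules (viewed as a full subcategory of the category of right $R$-modules) is said to have CSL (the converse of Schur's lemma) if every module $M$ in $\mathscr{C}$ whose endomorphism ring $\operatorname{End}(M_R)$ is a division ring is simple. The right Gabriel quiver of $R$ is the directed graph whose points are the isomorphism classes of simple right $R$-modules, with an arrow from the class of $S$ to the class of $T$ whenever $\operatorname{Ext}^1_R(S,T)\neq 0$; it is called totally disconnected if there are no arrows between any two different points (loops are allowed). Then the following conditions are equivalent: (i) the category of right $R$-modules of finite length has CSL; (ii) the right Gabriel quiver of $R$ is totally disconnected; (iii) $R$ is (isomorphic to) a finite direct product of full matrix rings over local rings; (iv) the category of all right $R$-modules has CSL. -/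

import Mathlib

open CategoryTheory

universe u

/-- The category of right modules over `R`, realised as modules over the opposite ring. -/
abbrev RightMod (R : Type u) [Ring R] : Type (u + 1) := ModuleCat.{u} Rᵐᵒᵖ

/-- The ring `D` is a division ring: it is nonzero and every nonzero element is invertible. -/
def IsDivRing (D : Type*) [Ring D] : Prop :=
  Nontrivial D ∧ ∀ x : D, x ≠ 0 → IsUnit x

/-- The converse of Schur's lemma for the full subcategory `C` of right modules: every object of
`C` whose endomorphism ring is a division ring is simple. -/
def HasCSL {R : Type u} [Ring R] (C : ObjectProperty (RightMod R)) : Prop :=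
  ∀ M : RightMod R, C M → IsDivRing (Module.End Rᵐᵒᵖ M) → IsSimpleModule Rᵐᵒᵖ M

/-- The right modules of finite length. -/
def FinLen (R : Type u) [Ring R] : ObjectProperty (RightMod R) :=
  fun M => IsFiniteLength Rᵐᵒᵖ M

/-- All right modules. -/
def AllMod (R : Type u) [Ring R] : ObjectProperty (RightMod R) :=
  fun _ => True

/-- The simple right modules. -/
abbrev SimpleRightMod (R : Type u) [Ring R] : Type (u + 1) :=
  {S : RightMod R // IsSimpleModule Rᵐᵒᵖ S}

/-- Isomorphism of simple right modules. -/
def simpleIsoSetoid (R : Type u) [Ring R] : Setoid (SimpleRightMod R) where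
  r S T := Nonempty (S.1 ≃ₗ[Rᵐᵒᵖ] T.1)
  iseqv :=
    { refl := fun S => ⟨LinearEquiv.refl Rᵐᵒᵖ S.1⟩
      symm := fun ⟨e⟩ => ⟨e.symm⟩
      trans := fun ⟨e⟩ ⟨f⟩ => ⟨e.trans f⟩ }

/-- The isomorphism classes of simple right modules. -/
def SimpleClass (R : Type u) [Ring R] : Type (u + 1) :=
  Quotient (simpleIsoSetoid R)

/-- The isomorphism class of a simple right module. -/
def SimpleClass.mk {R : Type u} [Ring R] (S : SimpleRightMod R) : SimpleClass R :=
  Quotient.mk (simpleIsoSetoid R) S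

/-- The right Gabriel quiver of `R`: its points are the isomorphism classes of simple right
modules, and there is an arrow from the class of `S` to the class of `T` when
`Ext¹(S, T)` is nonzero. -/
def rightGabrielQuiver (R : Type u) [Ring R] : Digraph (SimpleClass R) where
  Adj i j := ∃ S T : SimpleRightMod R, SimpleClass.mk S = i ∧ SimpleClass.mk T = j ∧
    Nontrivial (Abelian.Ext.{u} S.1 T.1 1)

/-- There are no arrows between two different points (loops are allowed). -/
def Digraph.TotallyDisconnected {V : Type*} (Q : Digraph V) : Prop :=
  ∀ i j : V, i ≠ j → ¬ Q.Adj i j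

/-- `R` is a finite direct product (possibly empty) of full matrix rings over local rings. -/
def IsProdMatrixLocal (R : Type u) [Ring R] : Prop :=
  ∃ (k : ℕ) (n : Fin k → ℕ) (A : Fin k → Type u) (_ : ∀ i, Ring (A i)),
    (∀ i, 0 < n i) ∧ (∀ i, IsLocalRing (A i)) ∧
      Nonempty (R ≃+* ((i : Fin k) → Matrix (Fin (n i)) (Fin (n i)) (A i)))

-- Everything is proved for left modules over a semiprimary ring `Q` with radical `J`. The theorem
-- takes `Q = Rᵐᵒᵖ`, which is again semiprimary, and being a product of matrix rings over local
-- rings passes to opposite rings.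
--
-- CSL in finite length forbids arrows: if `Ext¹(S, T) ≠ 0` for nonisomorphic simples, a nonsplit
-- extension of `S` by `T` is not simple, yet each of its nonzero endomorphisms is invertible
-- (`isUnit_end_of_nonsplit`).
--
-- Without arrows, lift the diagonal matrix units of `Q / J` to idempotents `e p`. Between different
-- blocks `e p * Q * e q` lies in `J`; vanishing of Ext pushes it into `J ^ 2`
-- (`mem_jacobson_sq_of_ext`), then into every power of `J`, so it is zero. Inside a block the
-- idempotents are equivalent with local corners, and `Q` is a product of matrix rings over these
-- corners.
--
-- Over such a product, a nonzero module `M` has a simple quotient `S` and a simple submodule `T`.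
-- If `End M` is a division ring, central idempotents force `S` and `T` into one block, where there
-- is only one simple module. Then `M → S ≃ T → M` is a nonzero endomorphism, hence invertible, and
-- `M ≃ S`.

universe v

/-! ### Extensions of simple modules; simple quotients and submodules -/

section ModuleTheory

variable {Q : Type u} [Ring Q]

lemma shortExact_of_linearMap {A B C : Type u} [AddCommGroup A] [AddCommGroup B] [AddCommGroup C]
    [Module Q A] [Module Q B] [Module Q C] {f : A →ₗ[Q] B} {g : B →ₗ[Q] C}
    (hf : Function.Injective f) (hg : Function.Surjective g) (h : Function.Exact f g) :
    (ShortComplex.mk (ModuleCat.ofHom f) (ModuleCat.ofHom g)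
      (by rw [← ModuleCat.ofHom_comp, h.linearMap_comp_eq_zero]; rfl)).ShortExact where
  exact := (ShortComplex.ShortExact.moduleCat_exact_iff_function_exact _).mpr h
  mono_f := (ModuleCat.mono_iff_injective _).mpr hf
  epi_g := (ModuleCat.epi_iff_surjective _).mpr hg

/-- `Ext¹(S, T)` is nonzero exactly when some linear map `K → T` from the kernel of a surjection
`P → S` with `P` projective does not extend to `P`. -/
lemma nontrivial_ext_one_iff {K P S T : Type u} [AddCommGroup K] [AddCommGroup P] [AddCommGroup S]
    [AddCommGroup T] [Module Q K] [Module Q P] [Module Q S] [Module Q T]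
    [Projective (ModuleCat.of Q P)] {i : K →ₗ[Q] P} {p : P →ₗ[Q] S}
    (hi : Function.Injective i) (hp : Function.Surjective p) (h : Function.Exact i p) :
    Nontrivial (Abelian.Ext.{u} (ModuleCat.of Q S) (ModuleCat.of Q T) 1) ↔
      ∃ g : K →ₗ[Q] T, ∀ l : P →ₗ[Q] T, l ∘ₗ i ≠ g := by
  have hS := shortExact_of_linearMap hi hp h
  constructor
  · intro hnt
    obtain ⟨x, hx⟩ := exists_ne (0 : Abelian.Ext.{u} (ModuleCat.of Q S) (ModuleCat.of Q T) 1)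
    -- Both directions read off the exact sequence `Hom(P, T) → Hom(K, T) → Ext¹(S, T) → Ext¹(P, T)
    -- = 0`.
    obtain ⟨y, hy⟩ := Abelian.Ext.contravariant_sequence_exact₃ hS (ModuleCat.of Q T) x
      (Abelian.Ext.eq_zero_of_projective (P := ModuleCat.of Q P) _) (n₀ := 0) rfl
    obtain ⟨g, rfl⟩ := Abelian.Ext.addEquiv₀.symm.surjective y
    refine ⟨g.hom, fun l hl ↦ hx ?_⟩
    have hg : g = ModuleCat.ofHom i ≫ ModuleCat.ofHom l := by
      ext x
      exact (LinearMap.congr_fun hl x).symm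
    rw [← hy, hg, Abelian.Ext.addEquiv₀_symm_apply, ← Abelian.Ext.mk₀_comp_mk₀]
    exact hS.extClass_comp_assoc _
  · rintro ⟨g, hg⟩
    by_contra hnt
    rw [not_nontrivial_iff_subsingleton] at hnt
    obtain ⟨y, hy⟩ := Abelian.Ext.contravariant_sequence_exact₁ hS (ModuleCat.of Q T)
      (Abelian.Ext.mk₀ (ModuleCat.ofHom g)) (n₁ := 1) rfl (Subsingleton.elim _ _)
    obtain ⟨l, rfl⟩ := Abelian.Ext.addEquiv₀.symm.surjective y
    rw [Abelian.Ext.addEquiv₀_symm_apply, Abelian.Ext.mk₀_comp_mk₀] at hy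
    have := Abelian.Ext.addEquiv₀.symm.injective hy
    exact hg l.hom (congrArg ModuleCat.Hom.hom this)

/-- Nonsplitness and `S ≄ T` give `Hom(S, M) = 0`. So `φ` cannot kill `T`, as it would factor
through `S`; hence `ker φ` meets `T` trivially and embeds in `S`. Were it nonzero, it would be a
copy of `S` splitting `q`. Thus `φ` is injective, and bijective since `M` is Artinian. -/
lemma isUnit_end_of_nonsplit {T M S : Type*} [AddCommGroup T] [AddCommGroup M] [AddCommGroup S]
    [Module Q T] [Module Q M] [Module Q S] [IsSimpleModule Q T] [IsSimpleModule Q S]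
    [IsArtinian Q M] {f : T →ₗ[Q] M} {q : M →ₗ[Q] S} (hf : Function.Injective f)
    (hex : Function.Exact f q) (hTS : IsEmpty (S ≃ₗ[Q] T))
    (hns : ∀ l : S →ₗ[Q] M, q ∘ₗ l ≠ LinearMap.id) (φ : Module.End Q M) (hφ : φ ≠ 0) :
    IsUnit φ := by
  have hsec : ∀ l : S →ₗ[Q] M, q ∘ₗ l = 0 := by
    intro l
    refine (LinearMap.bijective_or_eq_zero (q ∘ₗ l)).resolve_left fun hb ↦ ?_
    let e := LinearEquiv.ofBijective _ hb
    refine hns (l ∘ₗ e.symm.toLinearMap) (LinearMap.ext fun s ↦ ?_)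
    exact e.apply_symm_apply s
  have hST : ∀ l : S →ₗ[Q] M, l = 0 := by
    intro l
    have hr : ∀ s, l s ∈ LinearMap.range f := fun s ↦
      (hex (l s)).mp (LinearMap.congr_fun (hsec l) s)
    let e := LinearEquiv.ofInjective f hf
    let l' : S →ₗ[Q] T := e.symm.toLinearMap ∘ₗ l.codRestrict _ hr
    rcases LinearMap.bijective_or_eq_zero l' with hb | h0
    · exact hTS.elim (LinearEquiv.ofBijective _ hb)
    · ext s
      have := LinearMap.congr_fun h0 s
      have h2 : (l.codRestrict _ hr) s = 0 := e.symm.map_eq_zero_iff.mp this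
      simpa using congrArg Subtype.val h2
  have hinj : Function.Injective (φ ∘ₗ f) := by
    refine (LinearMap.injective_or_eq_zero _).resolve_right fun h0 ↦ hφ (LinearMap.ext fun m ↦ ?_)
    have hle : LinearMap.ker q ≤ LinearMap.ker φ := by
      intro m hm
      obtain ⟨t, rfl⟩ := (hex m).mp hm
      exact LinearMap.congr_fun h0 t
    by_contra hm
    have hsurj : Function.Surjective q :=
      (LinearMap.surjective_or_eq_zero q).resolve_right fun h ↦ hm (hle (by simp [h]))
    have h1 := hST ((LinearMap.ker q).liftQ φ hle ∘ₗ
      (LinearMap.quotKerEquivOfSurjective q hsurj).symm.toLinearMap)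
    have h2 : (LinearMap.quotKerEquivOfSurjective q hsurj).symm (q m) =
        (LinearMap.ker q).mkQ m := by
      rw [LinearEquiv.symm_apply_eq]; rfl
    have h3 := LinearMap.congr_fun h1 (q m)
    rw [LinearMap.comp_apply, LinearEquiv.coe_coe, h2] at h3
    exact hm h3
  have hker : ∀ x, φ x = 0 → q x = 0 → x = 0 := by
    intro x hx hq
    obtain ⟨t, rfl⟩ := (hex x).mp hq
    rw [(injective_iff_map_eq_zero _).mp hinj t hx, map_zero]
  rw [Module.End.isUnit_iff]
  apply IsArtinian.bijective_of_injective_endomorphism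
  refine (injective_iff_map_eq_zero _).mpr fun x hx ↦ hker x hx ?_
  by_contra hqx
  let k : LinearMap.ker φ →ₗ[Q] S := q ∘ₗ (LinearMap.ker φ).subtype
  have hk : Function.Bijective k :=
    ⟨(injective_iff_map_eq_zero _).mpr fun m hm ↦ Subtype.ext (hker m m.2 hm),
      (LinearMap.surjective_or_eq_zero k).resolve_right fun h ↦
        hqx (LinearMap.congr_fun h ⟨x, hx⟩)⟩
  let e := LinearEquiv.ofBijective k hk
  refine hns ((LinearMap.ker φ).subtype ∘ₗ e.symm.toLinearMap) (LinearMap.ext fun s ↦ ?_)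
  exact e.apply_symm_apply s

/-- A linear map `g : K → T` which does not extend along `K → P` gives a nonsplit extension of
`S = P / K` by `T`, the pushout. -/
lemma exists_nonsplit_of_not_extend {K P S T : Type u} [AddCommGroup K] [AddCommGroup P]
    [AddCommGroup S] [AddCommGroup T] [Module Q K] [Module Q P] [Module Q S] [Module Q T]
    {i : K →ₗ[Q] P} {p : P →ₗ[Q] S} (hi : Function.Injective i) (hp : Function.Surjective p)
    (h : Function.Exact i p) {g : K →ₗ[Q] T} (hg : ∀ l : P →ₗ[Q] T, l ∘ₗ i ≠ g) :
    ∃ (M : Type u) (_ : AddCommGroup M) (_ : Module Q M) (f : T →ₗ[Q] M) (q : M →ₗ[Q] S),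
      Function.Injective f ∧ Function.Surjective q ∧ Function.Exact f q ∧
      (∀ l : S →ₗ[Q] M, q ∘ₗ l ≠ LinearMap.id) ∧ ¬ Function.Surjective f := by
  let N : Submodule Q (T × P) := LinearMap.range (g.prod (-i))
  let q : (T × P) ⧸ N →ₗ[Q] S := N.liftQ (p ∘ₗ LinearMap.snd Q T P) (by
    rintro _ ⟨k, rfl⟩
    simp [h.apply_apply_eq_zero])
  let f : T →ₗ[Q] (T × P) ⧸ N := N.mkQ ∘ₗ LinearMap.inl Q T P
  have hf : Function.Injective f := by
    refine (injective_iff_map_eq_zero _).mpr fun t ht ↦ ?_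
    obtain ⟨k, hk⟩ := (Submodule.Quotient.mk_eq_zero N).mp ht
    have h1 : g k = t := congrArg Prod.fst hk
    have h2 : -i k = 0 := congrArg Prod.snd hk
    rw [← h1, (injective_iff_map_eq_zero _).mp hi k (neg_eq_zero.mp h2), map_zero]
  have hq : Function.Surjective q := fun s ↦ by
    obtain ⟨x, rfl⟩ := hp s
    exact ⟨N.mkQ (0, x), rfl⟩
  have hrel : ∀ k, N.mkQ (0, i k) = f (g k) := fun k ↦
    ((Submodule.Quotient.eq N).mpr ⟨-k, by simp⟩)
  have hex : Function.Exact f q := by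
    intro m
    obtain ⟨⟨t, x⟩, rfl⟩ := N.mkQ_surjective m
    constructor
    · intro hm
      obtain ⟨k, rfl⟩ := (h x).mp hm
      refine ⟨t + g k, ?_⟩
      rw [map_add, ← hrel]
      change N.mkQ (t, 0) + _ = _
      rw [← map_add]
      simp
    · rintro ⟨t', ht'⟩
      rw [← ht']
      exact map_zero p
  -- A retraction of `f`, restricted to `P`, would extend `g`.
  have hret : ∀ r : (T × P) ⧸ N →ₗ[Q] T, r ∘ₗ f ≠ LinearMap.id := by
    intro r hr
    refine hg (r ∘ₗ N.mkQ ∘ₗ LinearMap.inr Q T P) (LinearMap.ext fun k ↦ ?_)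
    change r (N.mkQ (0, i k)) = g k
    rw [hrel]
    exact LinearMap.congr_fun hr (g k)
  refine ⟨(T × P) ⧸ N, inferInstance, inferInstance, f, q, hf, hq, hex, fun l hl ↦ ?_, fun hs ↦ ?_⟩
  · obtain ⟨r, hr⟩ := ((hex.split_tfae hf hq).out 0 1 rfl rfl).mp ⟨l, hl⟩
    exact hret r hr
  · let e := LinearEquiv.ofBijective f ⟨hf, hs⟩
    exact hret e.symm.toLinearMap (LinearMap.ext e.symm_apply_apply)

lemma isSimpleModule_of_injective_to_simple {M S : Type*} [AddCommGroup M] [AddCommGroup S]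
    [Module Q M] [Module Q S] [Nontrivial M] [IsSimpleModule Q S] (f : M →ₗ[Q] S)
    (hf : Function.Injective f) : IsSimpleModule Q M := by
  have hs : Function.Surjective f := (LinearMap.surjective_or_eq_zero f).resolve_right fun h ↦ by
    obtain ⟨m, hm⟩ := exists_ne (0 : M)
    exact hm (hf (by simp [h]))
  exact IsSimpleModule.congr (LinearEquiv.ofBijective f ⟨hf, hs⟩)

/-- If every module of finite length whose endomorphism ring is a division ring is simple, then
there are no extensions between nonisomorphic simple modules. -/
lemma subsingleton_ext_one_of_csl
    (hcsl : ∀ M : ModuleCat.{u} Q, IsFiniteLength Q M → IsDivRing (Module.End Q M) →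
      IsSimpleModule Q M)
    (S T : ModuleCat.{u} Q) [IsSimpleModule Q S] [IsSimpleModule Q T]
    (hST : IsEmpty (S ≃ₗ[Q] T)) : ¬ Nontrivial (Abelian.Ext.{u} S T 1) := by
  intro hnt
  have := IsSimpleModule.nontrivial Q S
  have := IsSimpleModule.nontrivial Q T
  obtain ⟨s, hs⟩ := exists_ne (0 : S)
  let p := LinearMap.toSpanSingleton Q S s
  have hp : Function.Surjective p := IsSimpleModule.toSpanSingleton_surjective Q hs
  have hi := (LinearMap.ker p).injective_subtype
  have hex : Function.Exact (LinearMap.ker p).subtype p := LinearMap.exact_subtype_ker_map p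
  have : Projective (ModuleCat.of Q Q) :=
    ModuleCat.projective_of_free (Module.Basis.singleton Unit Q)
  obtain ⟨g, hg⟩ := (nontrivial_ext_one_iff (T := T) hi hp hex).mp hnt
  obtain ⟨M, _, _, f, q, hf, hq, hfq, hns, hfs⟩ := exists_nonsplit_of_not_extend hi hp hex hg
  have : IsNoetherian Q M := isNoetherian_of_range_eq_ker f q hfq.linearMap_ker_eq.symm
  have : IsArtinian Q M := isArtinian_of_range_eq_ker f q hfq.linearMap_ker_eq.symm
  have hMn : Nontrivial M := hf.nontrivial
  have := hcsl (ModuleCat.of Q M)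
    (isFiniteLength_iff_isNoetherian_isArtinian.mpr ⟨‹_›, ‹_›⟩)
    ⟨inferInstanceAs (Nontrivial (Module.End Q M)), fun φ hφ ↦
      isUnit_end_of_nonsplit hf hfq hST hns φ hφ⟩
  have hM : IsSimpleModule Q M := this
  exact hfs ((LinearMap.surjective_or_eq_zero f).resolve_right fun h0 ↦ by
    obtain ⟨t, ht⟩ := exists_ne (0 : T)
    exact ht (hf (by simp [h0])))

/-- A module whose endomorphism ring is a division ring and which has isomorphic simple quotient
and simple submodule is simple. -/
lemma isSimpleModule_of_quotient_equiv_sub {M S T : Type*} [AddCommGroup M] [AddCommGroup S]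
    [AddCommGroup T] [Module Q M] [Module Q S] [Module Q T] [IsSimpleModule Q S]
    [IsSimpleModule Q T] (hM : IsDivRing (Module.End Q M)) (p : M →ₗ[Q] S)
    (hp : Function.Surjective p) (i : T →ₗ[Q] M) (hi : Function.Injective i) (e : S ≃ₗ[Q] T) :
    IsSimpleModule Q M := by
  have := IsSimpleModule.nontrivial Q S
  have : Nontrivial M := hp.nontrivial
  let φ : Module.End Q M := i ∘ₗ e.toLinearMap ∘ₗ p
  have hφ : φ ≠ 0 := by
    obtain ⟨s, hs⟩ := exists_ne (0 : S)
    obtain ⟨m, rfl⟩ := hp s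
    intro h
    have h1 : i (e (p m)) = 0 := LinearMap.congr_fun h m
    exact hs (e.map_eq_zero_iff.mp ((injective_iff_map_eq_zero _).mp hi _ h1))
  have hb := (Module.End.isUnit_iff φ).mp (hM.2 φ hφ)
  refine isSimpleModule_of_injective_to_simple p fun x y hxy ↦ hb.1 ?_
  change i (e (p x)) = i (e (p y))
  rw [hxy]

/-- Such a module is a module over the semisimple ring `Q / J`, with the same submodules. -/
lemma isSemisimpleModule_of_jacobson_smul_eq_zero [IsSemiprimaryRing Q] {M : Type*}
    [AddCommGroup M] [Module Q M] (h : ∀ r ∈ Ring.jacobson Q, ∀ m : M, r • m = 0) :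
    IsSemisimpleModule Q M := by
  have hT : Module.IsTorsionBySet Q M (Ring.jacobson Q : Set Q) := fun m r ↦ h r r.2 m
  let _ := hT.module
  exact (hT.semilinearMap.isSemisimpleModule_iff_of_bijective Function.bijective_id).2
    inferInstance

/-- Nilpotency of `J` gives Nakayama's lemma without finiteness: `J M = M` would force `M = J ^ n M
= 0`. So `M / J M` is nonzero and semisimple, and has a maximal submodule. -/
lemma exists_simple_quotient [IsSemiprimaryRing Q] (M : Type v) [AddCommGroup M] [Module Q M]
    [Nontrivial M] :
    ∃ (S : Type v) (_ : AddCommGroup S) (_ : Module Q S) (p : M →ₗ[Q] S),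
      IsSimpleModule Q S ∧ Function.Surjective p := by
  let J := Ring.jacobson Q
  have hne : J • (⊤ : Submodule Q M) ≠ ⊤ := by
    intro h
    obtain ⟨n, hn⟩ := IsSemiprimaryRing.isNilpotent (R := Q)
    have hpow : ∀ k : ℕ, J ^ k • (⊤ : Submodule Q M) = ⊤ := by
      intro k
      induction k with
      | zero => rw [Submodule.pow_zero, Ideal.one_eq_top, Submodule.top_smul]
      | succ k ih => rw [Submodule.pow_succ, Submodule.mul_smul, h, ih]
    have := hpow n
    rw [hn, Submodule.zero_eq_bot, Submodule.bot_smul] at this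
    exact bot_ne_top this
  have : Nontrivial (M ⧸ J • (⊤ : Submodule Q M)) := Submodule.Quotient.nontrivial_iff.mpr hne
  have : IsSemisimpleModule Q (M ⧸ J • (⊤ : Submodule Q M)) := by
    refine isSemisimpleModule_of_jacobson_smul_eq_zero fun r hr m ↦ ?_
    obtain ⟨m, rfl⟩ := Submodule.mkQ_surjective _ m
    rw [← map_smul]
    exact (Submodule.Quotient.mk_eq_zero _).mpr (Submodule.smul_mem_smul hr trivial)
  obtain ⟨N, hN, -⟩ := (IsCoatomic.eq_top_or_exists_le_coatom
    (⊥ : Submodule Q (M ⧸ J • (⊤ : Submodule Q M)))).resolve_left bot_ne_top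
  exact ⟨_ ⧸ N, inferInstance, inferInstance, N.mkQ ∘ₗ Submodule.mkQ _,
    isSimpleModule_iff_isCoatom.mpr hN, N.mkQ_surjective.comp (Submodule.mkQ_surjective _)⟩

/-- The last nonzero term of the chain `J ^ k M` is killed by `J`, hence semisimple. -/
lemma exists_simple_submodule [IsSemiprimaryRing Q] (M : Type*) [AddCommGroup M] [Module Q M]
    [Nontrivial M] : ∃ N : Submodule Q M, IsSimpleModule Q N := by
  let J := Ring.jacobson Q
  have hex : ∃ n : ℕ, J ^ n • (⊤ : Submodule Q M) = ⊥ := by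
    obtain ⟨n, hn⟩ := IsSemiprimaryRing.isNilpotent (R := Q)
    exact ⟨n, by rw [hn, Submodule.zero_eq_bot, Submodule.bot_smul]⟩
  classical
  obtain ⟨k, hk⟩ : ∃ k, Nat.find hex = k + 1 := Nat.exists_eq_succ_of_ne_zero fun h0 ↦ by
    have := Nat.find_spec hex
    rw [h0, Submodule.pow_zero, Ideal.one_eq_top, Submodule.top_smul] at this
    exact top_ne_bot this
  have hne := Nat.find_min hex (m := k) (by omega)
  have hz := Nat.find_spec hex
  rw [hk, Ideal.IsTwoSided.pow_succ, Submodule.mul_smul] at hz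
  let L : Submodule Q M := J ^ k • (⊤ : Submodule Q M)
  have : Nontrivial L := (Submodule.nontrivial_iff_ne_bot).mpr hne
  have : IsSemisimpleModule Q L := by
    refine isSemisimpleModule_of_jacobson_smul_eq_zero fun r hr m ↦ Subtype.ext ?_
    exact (Submodule.mem_bot Q).mp (hz ▸ Submodule.smul_mem_smul hr m.2)
  obtain ⟨N, hN⟩ := IsSemisimpleModule.exists_simple_submodule Q L
  exact ⟨N.map L.subtype, IsSimpleModule.congr (L.equivSubtypeMap N).symm⟩

end ModuleTheory

/-! ### Simple modules over products of matrix rings over local rings -/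

section SimpleModules

variable {Q : Type*} [Ring Q]

/-- The idempotent `a * b` is a unit or its complement is, so it is `1` or `0`; the latter would
give `1 = 0`. -/
lemma IsLocalRing.isUnit_of_mul_eq_one {A : Type*} [Ring A] [IsLocalRing A] {a b : A}
    (h : b * a = 1) : IsUnit a := by
  have hidem : (a * b) * (a * b) = a * b := by
    rw [mul_assoc, ← mul_assoc b, h, one_mul]
  rcases IsLocalRing.isUnit_or_isUnit_of_add_one (add_sub_cancel (a * b) 1) with hu | hu
  · exact isUnit_iff_exists.mpr ⟨b, hu.mul_left_cancel (by rw [hidem, mul_one]), h⟩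
  · have h0 : a * b = 0 := hu.mul_right_cancel (by rw [mul_sub, mul_one, hidem, sub_self, zero_mul])
    have : (1 : A) = 0 := by
      rw [← mul_one 1, ← h, mul_assoc b a, ← mul_assoc a, h0, zero_mul, mul_zero]
    exact absurd this one_ne_zero

/-- The right-hand side does not mention `S`, so the annihilator of `e • s` is the same for every
simple module not killed by `e`. What makes this work is that `ι a` kills `s` exactly when `a` is a
nonunit. -/
lemma smul_eq_zero_iff_of_local_corner {A : Type*} [Ring A] [IsLocalRing A] {e : Q}
    (ι : A →ₙ+* Q) (hι : ι 1 = e) (hcorner : ∀ q : Q, ∃ a, e * q * e = ι a)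
    {S : Type*} [AddCommGroup S] [Module Q S] [IsSimpleModule Q S] {s : S} (hs : e • s ≠ 0)
    (q : Q) : q • e • s = 0 ↔ ∀ r : Q, ∀ a, e * (r * q) * e = ι a → ¬ IsUnit a := by
  have hee : e * e = e := by rw [← hι, ← map_mul, mul_one]
  have hev : ∀ a, e * ι a = ι a := fun a ↦ by rw [← hι, ← map_mul, one_mul]
  have hunit : ∀ a, IsUnit a → ι a • s ≠ 0 := by
    rintro a ⟨u, rfl⟩ h0
    apply hs
    rw [← hι, ← u.inv_mul, map_mul, mul_smul, h0, smul_zero]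
  have hnonunit : ∀ a, ¬ IsUnit a → ι a • s = 0 := by
    intro a ha
    by_contra h0
    obtain ⟨r, hr⟩ := IsSimpleModule.toSpanSingleton_surjective Q h0 (e • s)
    obtain ⟨b, hb⟩ := hcorner r
    have h1 : ι (b * a) • s = e • s := by
      rw [map_mul, ← hb, mul_assoc, hev, mul_assoc, mul_smul, mul_smul]
      rw [LinearMap.toSpanSingleton_apply] at hr
      rw [hr, ← mul_smul, hee]
    have h2 : ι (1 - b * a) • s = 0 := by rw [map_sub, sub_smul, h1, hι, sub_self]
    -- Since `b * a` fixes `e • s`, the element `1 - b * a` kills `s` and is no unit; so `b * a` is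
    -- a unit, and then so is `a`.
    rcases IsLocalRing.isUnit_or_isUnit_of_add_one (add_sub_cancel (b * a) 1) with hu | hu
    · obtain ⟨u, hu⟩ := hu
      exact ha (IsLocalRing.isUnit_of_mul_eq_one (b := ↑u⁻¹ * b)
        (by rw [mul_assoc, ← hu, u.inv_mul]))
    · exact hunit _ hu h2
  constructor
  · intro h r a hra hu
    apply hunit a hu
    rw [← hra, mul_smul, mul_smul, mul_smul, h, smul_zero, smul_zero]
  · intro h
    by_contra h0
    obtain ⟨r, hr⟩ := IsSimpleModule.toSpanSingleton_surjective Q h0 (e • s)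
    rw [LinearMap.toSpanSingleton_apply] at hr
    obtain ⟨a, ha⟩ := hcorner (r * q)
    have := hnonunit a (h r a ha)
    rw [← ha, mul_smul, mul_smul, mul_smul, hr, ← mul_smul, hee] at this
    exact hs this

/-- If `e` is an idempotent of `Q` whose corner ring is the image of a local ring, then there is
at most one simple module not killed by `e`. -/
lemma nonempty_linearEquiv_of_local_corner {A : Type*} [Ring A] [IsLocalRing A] {e : Q}
    (ι : A →ₙ+* Q) (hι : ι 1 = e) (hcorner : ∀ q : Q, ∃ a, e * q * e = ι a)
    {S T : Type*} [AddCommGroup S] [AddCommGroup T] [Module Q S] [Module Q T]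
    [IsSimpleModule Q S] [IsSimpleModule Q T] {s : S} (hs : e • s ≠ 0) {t : T} (ht : e • t ≠ 0) :
    Nonempty (S ≃ₗ[Q] T) := by
  have hker : LinearMap.ker (LinearMap.toSpanSingleton Q S (e • s)) =
      LinearMap.ker (LinearMap.toSpanSingleton Q T (e • t)) := by
    ext q
    exact (smul_eq_zero_iff_of_local_corner ι hι hcorner hs q).trans
      (smul_eq_zero_iff_of_local_corner ι hι hcorner ht q).symm
  exact ⟨(LinearMap.quotKerEquivOfSurjective _
      (IsSimpleModule.toSpanSingleton_surjective Q hs)).symm ≪≫ₗ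
    Submodule.quotEquivOfEq _ _ hker ≪≫ₗ
    LinearMap.quotKerEquivOfSurjective _ (IsSimpleModule.toSpanSingleton_surjective Q ht)⟩

/-- Multiplication by a central element, as an endomorphism of a module. -/
def centralSMul (M : Type*) [AddCommGroup M] [Module Q M] (c : Q) (hc : ∀ q, c * q = q * c) :
    Module.End Q M where
  toFun m := c • m
  map_add' := smul_add c
  map_smul' q m := by rw [RingHom.id_apply, ← mul_smul, ← mul_smul, hc]

/-- Over a semiprimary product of matrix rings over local rings, every module whose endomorphism
ring is a division ring is simple. -/
lemma isSimpleModule_of_isDivRing_end {Q : Type u} [Ring Q] [IsSemiprimaryRing Q]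
    (hQ : IsProdMatrixLocal Q) {M : Type*} [AddCommGroup M] [Module Q M]
    (hM : IsDivRing (Module.End Q M)) : IsSimpleModule Q M := by
  obtain ⟨k, n, A, _, hn, hA, ⟨ψ⟩⟩ := hQ
  have : Nontrivial M := by
    by_contra h
    rw [not_nontrivial_iff_subsingleton] at h
    obtain ⟨x, y, hxy⟩ := hM.1
    exact hxy (LinearMap.ext fun m ↦ Subsingleton.elim _ _)
  obtain ⟨S, _, _, p, hS, hp⟩ := exists_simple_quotient (Q := Q) M
  obtain ⟨T, hT⟩ := exists_simple_submodule (Q := Q) M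
  let z (i) : Fin (n i) := ⟨0, hn i⟩
  -- `c i` is the central idempotent of block `i`, and `e i` its first diagonal matrix unit, whose
  -- corner is `A i`.
  let c (i) : Q := ψ.symm (Pi.single i 1)
  let e (i) : Q := ψ.symm (Pi.single i (Matrix.single (z i) (z i) 1))
  have hc : ∀ i q, c i * q = q * c i := by
    intro i q
    apply ψ.injective
    ext j : 1
    by_cases h : j = i
    · subst h; simp [c]
    · simp [c, h]
  have hcc : ∀ i j, i ≠ j → c i * c j = 0 := by
    intro i j hij
    apply ψ.injective
    ext l : 1
    by_cases h : l = i
    · subst h; simp [c, hij]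
    · simp [c, h]
  have hec : ∀ i, e i * c i = e i := by
    intro i
    apply ψ.injective
    simp [c, e, ← Pi.single_mul]
  have hexists : ∀ (S : Type _) [AddCommGroup S] [Module Q S] [Nontrivial S],
      ∃ i, ∃ s : S, e i • s ≠ 0 := by
    intro S _ _ _
    by_contra! hall
    obtain ⟨s, hs⟩ := exists_ne (0 : S)
    -- The `e i` generate the unit ideal, so no nonzero module is killed by all of them.
    have h1 : (1 : Q) = ∑ i, ∑ a, ψ.symm (Pi.single i (Matrix.single a (z i) 1)) * (e i *
        ψ.symm (Pi.single i (Matrix.single (z i) a 1))) := by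
      apply ψ.injective
      simp only [map_sum, map_mul, e, RingEquiv.apply_symm_apply, ← Pi.single_mul,
        Matrix.single_mul_single_same, mul_one, map_one]
      ext i : 1
      rw [Finset.sum_apply, Finset.sum_eq_single i]
      · rw [Finset.sum_apply]
        simp only [Pi.single_eq_same, Pi.one_apply]
        exact Matrix.sum_single_one.symm
      · intro j _ hj
        rw [Finset.sum_apply]
        exact Finset.sum_eq_zero fun a _ ↦ by rw [Pi.single_eq_of_ne hj.symm]
      · simp
    apply hs
    rw [← one_smul Q s, h1, Finset.sum_smul]
    refine Finset.sum_eq_zero fun i _ ↦ ?_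
    rw [Finset.sum_smul]
    exact Finset.sum_eq_zero fun a _ ↦ by rw [mul_smul, mul_smul, hall, smul_zero]
  have := IsSimpleModule.nontrivial Q S
  have := IsSimpleModule.nontrivial Q T
  obtain ⟨i, s, hs⟩ := hexists S
  obtain ⟨j, t, ht⟩ := hexists T
  have hi : centralSMul M (c i) (hc i) ≠ 0 := by
    intro h
    obtain ⟨m, rfl⟩ := hp s
    have h0 : c i • m = 0 := LinearMap.congr_fun h m
    apply hs
    rw [← hec, mul_smul, ← map_smul p, h0, map_zero, smul_zero]
  have hj : centralSMul M (c j) (hc j) ≠ 0 := by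
    intro h
    have h0 : c j • (t : M) = 0 := LinearMap.congr_fun h t
    apply ht
    rw [← hec, mul_smul]
    exact Subtype.ext (by simp [h0])
  -- For `i ≠ j`, `c i` and `c j` would act as nonzero elements of a division ring with product
  -- zero.
  have hij : i = j := by
    by_contra hij
    refine hj ((hM.2 _ hi).mul_right_eq_zero.mp (LinearMap.ext fun m ↦ ?_))
    change c i • c j • m = 0
    rw [← mul_smul, hcc i j hij, zero_smul]
  subst hij
  have hA := hA i
  let ι : A i →ₙ+* Q :=
    { toFun a := ψ.symm (Pi.single i (Matrix.single (z i) (z i) a))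
      map_mul' a b := by
        rw [← map_mul, ← Pi.single_mul, Matrix.single_mul_single_same]
      map_zero' := by simp
      map_add' a b := by rw [Matrix.single_add, Pi.single_add, map_add] }
  have hcorner : ∀ q : Q, ∃ a, e i * q * e i = ι a := by
    intro q
    refine ⟨ψ q i (z i) (z i), ψ.injective ?_⟩
    change _ = ψ (ψ.symm _)
    simp only [map_mul, e, RingEquiv.apply_symm_apply]
    ext j : 1
    by_cases h : j = i
    · subst h; simp
    · simp [h]
  obtain ⟨E⟩ := nonempty_linearEquiv_of_local_corner ι rfl hcorner hs ht
  exact isSimpleModule_of_quotient_equiv_sub hM p hp T.subtype T.injective_subtype E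

end SimpleModules

/-! ### Passing to the opposite ring -/

section Opposite

/-- A nilpotent ideal lies in the radical, and an ideal with semisimple quotient contains it, so the
kernel is the radical. For `Rᵐᵒᵖ` this avoids proving left-right symmetry of the radical separately.
-/
lemma isSemiprimaryRing_of_surjective {Q B : Type*} [Ring Q] [Ring B] [IsSemisimpleRing B]
    (f : Q →+* B) (hf : Function.Surjective f) {n : ℕ} (hn : RingHom.ker f ^ n = ⊥) :
    IsSemiprimaryRing Q := by
  have hle : RingHom.ker f ≤ Ring.jacobson Q := by
    intro x hx
    rw [Ring.jacobson_eq_sInf_isMaximal, Submodule.mem_sInf]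
    intro m (hm : Ideal.IsMaximal m)
    by_contra hxm
    obtain ⟨y, a, ha, hy⟩ := hm.exists_inv hxm
    have hnil : IsNilpotent (y * x) := ⟨n, by
      simpa [hn] using Ideal.pow_mem_pow (Ideal.mul_mem_left _ y hx) n⟩
    have hu : IsUnit a := by
      rw [← eq_sub_iff_add_eq'] at hy
      exact hy ▸ hnil.isUnit_one_sub
    exact hm.ne_top (Ideal.eq_top_of_isUnit_mem _ ha hu)
  let E : (Q ⧸ RingHom.ker f) ≃+* B := RingHom.quotientKerEquivOfSurjective hf
  have hss : IsSemisimpleRing (Q ⧸ RingHom.ker f) := E.symm.isSemisimpleRing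
  have heq : RingHom.ker f = Ring.jacobson Q :=
    le_antisymm hle (Ring.jacobson_le_of_eq_bot (IsSemisimpleRing.jacobson_eq_bot _))
  exact ⟨(Ideal.quotientEquiv _ _ (RingEquiv.refl Q) (by simpa using heq.symm)).isSemisimpleRing,
    n, by rw [← heq, hn]; rfl⟩

instance IsSemiprimaryRing.mulOpposite {R : Type*} [Ring R] [IsSemiprimaryRing R] :
    IsSemiprimaryRing Rᵐᵒᵖ := by
  obtain ⟨n, hn⟩ := IsSemiprimaryRing.isNilpotent (R := R)
  let f : Rᵐᵒᵖ →+* (R ⧸ Ring.jacobson R)ᵐᵒᵖ := (Ideal.Quotient.mk (Ring.jacobson R)).op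
  refine isSemiprimaryRing_of_surjective f (n := n) (fun x ↦ ?_) ?_
  · obtain ⟨y, hy⟩ := Ideal.Quotient.mk_surjective x.unop
    exact ⟨.op y, MulOpposite.unop_injective hy⟩
  · have hpow : ∀ k, ∀ x ∈ RingHom.ker f ^ k, x.unop ∈ Ring.jacobson R ^ k := by
      intro k
      induction k with
      | zero => intro x _; rw [Submodule.pow_zero, Ideal.one_eq_top]; trivial
      | succ k ih =>
        intro x hx
        rw [Submodule.pow_succ] at hx
        refine Submodule.smul_induction_on hx (fun a ha b hb ↦ ?_) fun _ _ ha hb ↦ ?_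
        · rw [Ideal.IsTwoSided.pow_succ, smul_eq_mul, MulOpposite.unop_mul]
          exact Ideal.mul_mem_mul (Ideal.Quotient.eq_zero_iff_mem.mp
            (congrArg MulOpposite.unop hb)) (ih a ha)
        · exact add_mem ha hb
    rw [eq_bot_iff]
    intro x hx
    have := hpow n x hx
    rw [hn] at this
    exact MulOpposite.unop_injective this

lemma IsLocalRing.mulOpposite {A : Type*} [Ring A] [IsLocalRing A] : IsLocalRing Aᵐᵒᵖ where
  isUnit_or_isUnit_of_add_one h :=
    (IsLocalRing.isUnit_or_isUnit_of_add_one (congrArg MulOpposite.unop h)).imp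
      (fun h ↦ h.op) fun h ↦ h.op

lemma IsProdMatrixLocal.of_ringEquiv {R R' : Type u} [Ring R] [Ring R'] (e : R ≃+* R')
    (h : IsProdMatrixLocal R') : IsProdMatrixLocal R := by
  obtain ⟨k, n, A, i, hn, hA, ⟨ψ⟩⟩ := h
  exact ⟨k, n, A, i, hn, hA, ⟨e.trans ψ⟩⟩

lemma IsProdMatrixLocal.mulOpposite {R : Type u} [Ring R] (h : IsProdMatrixLocal R) :
    IsProdMatrixLocal Rᵐᵒᵖ := by
  obtain ⟨k, n, A, _, hn, hA, ⟨ψ⟩⟩ := h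
  exact ⟨k, n, fun i ↦ (A i)ᵐᵒᵖ, inferInstance, hn, fun i ↦ have := hA i; IsLocalRing.mulOpposite,
    ⟨ψ.op.trans ((RingEquiv.piMulOpposite _).trans
      (RingEquiv.piCongrRight fun i ↦ RingEquiv.mopMatrix.symm))⟩⟩

lemma isProdMatrixLocal_mulOpposite_iff {R : Type u} [Ring R] :
    IsProdMatrixLocal Rᵐᵒᵖ ↔ IsProdMatrixLocal R :=
  ⟨fun h ↦ h.mulOpposite.of_ringEquiv (RingEquiv.opOp R), fun h ↦ h.mulOpposite⟩

end Opposite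

/-! ### Lifting modulo nil ideals, local corners and matrix units -/

section Idempotents

variable {Q : Type*} [Ring Q]

/-- Idempotents which are equivalent modulo a nil ideal are equivalent. -/
lemma exists_mul_eq_and_mul_eq_of_map {B : Type*} [Ring B] (f : Q →+* B)
    (hker : ∀ x, f x = 0 → IsNilpotent x) {e e' : Q} (he : IsIdempotentElem e)
    (he' : IsIdempotentElem e') {x y : Q} (hxy : f x * f y = f e) (hyx : f y * f x = f e') :
    ∃ x' y', x' * y' = e ∧ y' * x' = e' ∧ x' * e' = x' ∧ e' * y' = y' := by
  have hfe : f e * f e = f e := by rw [← map_mul, he.eq]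
  have hfe' : f e' * f e' = f e' := by rw [← map_mul, he'.eq]
  have hx1 : f (e * x * e') = f e * f x := by
    rw [map_mul, map_mul, ← hyx, ← mul_assoc, mul_assoc (f e), hxy, hfe]
  have hy1 : f (e' * y * e) = f e' * f y := by
    rw [map_mul, map_mul, ← hxy, ← mul_assoc, mul_assoc (f e'), hyx, hfe']
  set x₁ := e * x * e' with hx₁
  set y₁ := e' * y * e with hy₁
  have hex : e * x₁ = x₁ := by rw [hx₁, ← mul_assoc, ← mul_assoc, he.eq]
  have hxe : x₁ * e' = x₁ := by rw [hx₁, mul_assoc, he'.eq]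
  have hey : e' * y₁ = y₁ := by rw [hy₁, ← mul_assoc, ← mul_assoc, he'.eq]
  have hxy1 : f x₁ * f y₁ = f e := by
    rw [hx1, hy1, ← hyx, ← hxy]
    simp only [mul_assoc]
    simp only [← mul_assoc, hxy]
    simp only [hfe]
  have hyx1 : f y₁ * f x₁ = f e' := by
    rw [hx1, hy1, ← hyx, ← hxy]
    simp only [mul_assoc]
    simp only [← mul_assoc, hyx]
    simp only [hfe']
  -- `x₁ * y₁` agrees with `e` up to a nilpotent error; the unit `u = 1 - (e - x₁ * y₁)` satisfies
  -- `e * u = x₁ * y₁`, so replacing `y₁` by `y₁ * u⁻¹` makes the product exactly `e`.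
  obtain ⟨u, hu⟩ := (hker (e - x₁ * y₁) (by rw [map_sub, map_mul, hxy1, sub_self])).isUnit_one_sub
  have heu : e * u = x₁ * y₁ := by
    rw [hu, mul_sub, mul_one, mul_sub, he.eq, ← mul_assoc, hex]; abel
  have hfu : f (↑u⁻¹ : Q) = 1 := by
    have h1 : f u = 1 := by rw [hu, map_sub, map_sub, map_mul, hxy1, sub_self, sub_zero, map_one]
    rw [← one_mul (f _)]
    nth_rw 1 [← h1]
    rw [← map_mul, u.mul_inv, map_one]
  have hprod : x₁ * (y₁ * ↑u⁻¹) = e := by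
    rw [← mul_assoc, ← heu, mul_assoc, u.mul_inv, mul_one]
  refine ⟨x₁, y₁ * ↑u⁻¹, hprod, ?_, hxe, by rw [← mul_assoc, hey]⟩
  set w := y₁ * ↑u⁻¹ * x₁ with hw
  have hww : w * w = w := by
    calc w * w = y₁ * ↑u⁻¹ * (x₁ * (y₁ * ↑u⁻¹)) * x₁ := by simp only [hw, mul_assoc]
      _ = w := by rw [hprod, mul_assoc, hex]
  have hew : e' * w = w := by rw [hw, mul_assoc y₁, ← mul_assoc e', hey]
  have hwe : w * e' = w := by rw [hw, mul_assoc, hxe]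
  -- The reverse product `w` needs no further correction: `e' - w` is both idempotent and nilpotent,
  -- hence zero.
  have hidem : IsIdempotentElem (e' - w) := by
    change (e' - w) * (e' - w) = e' - w
    rw [mul_sub, sub_mul, sub_mul, he'.eq, hwe, hew, hww, sub_self, sub_zero]
  refine (sub_eq_zero.mp (hidem.eq_zero_of_isNilpotent (hker _ ?_))).symm
  rw [map_sub, hw, map_mul, map_mul, hfu, mul_one, hyx1, sub_self]

/-- A left inverse of an element outside the kernel of `g` is again outside it, so has a left
inverse too, and both are units. If `a + b = 1`, not both lie in the kernel. -/
lemma isLocalRing_of_exists_mul_eq_one {C B : Type*} [Ring C] [Ring B] (g : C →ₙ+* B)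
    (h1 : g 1 ≠ 0) (h : ∀ a, g a ≠ 0 → ∃ b, b * a = 1) : IsLocalRing C := by
  have : Nontrivial C := ⟨1, 0, fun h0 ↦ h1 (by rw [h0, map_zero])⟩
  have hunit : ∀ a, g a ≠ 0 → IsUnit a := by
    intro a ha
    obtain ⟨b, hb⟩ := h a ha
    obtain ⟨c, hc⟩ := h b fun h0 ↦ h1 (by rw [← hb, map_mul, h0, zero_mul])
    have hca : c = a := by rw [← mul_one c, ← hb, ← mul_assoc, hc, one_mul]
    exact isUnit_iff_exists.mpr ⟨b, hca ▸ hc, hb⟩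
  refine ⟨fun {a b} hab ↦ ?_⟩
  by_cases ha : g a = 0
  · refine .inr (hunit b fun hb ↦ h1 ?_)
    rw [← hab, map_add, ha, hb, add_zero]
  · exact .inl (hunit a ha)

/-- The hypothesis `h` says that `f e` generates a simple left ideal of the image of `f`. Left
inverses in the corner of `f e` then lift, because an element of the form `e` minus a nilpotent can
be corrected by a unit. -/
lemma isLocalRing_corner {B : Type*} [Ring B] (f : Q →+* B)
    (hker : ∀ x, f x = 0 → IsNilpotent x) {e : Q} (he : IsIdempotentElem e) (hfe : f e ≠ 0)
    (h : ∀ r, f (r * e) ≠ 0 → ∃ s, f (s * (r * e)) = f e) : IsLocalRing he.Corner := by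
  let g : he.Corner →ₙ+* B :=
    { toFun a := f a.1
      map_mul' a b := map_mul f _ _
      map_zero' := map_zero f
      map_add' a b := map_add f _ _ }
  refine isLocalRing_of_exists_mul_eq_one g hfe fun a ha ↦ ?_
  obtain ⟨hea, hae⟩ := (Subsemigroup.mem_corner_iff he).mp a.2
  obtain ⟨s, hs⟩ := h a.1 (by rw [hae]; exact ha)
  rw [hae] at hs
  obtain ⟨u, hu⟩ := (hker (e - e * s * a.1)
    (by rw [map_sub, mul_assoc, map_mul, hs, ← map_mul, he.eq, sub_self])).isUnit_one_sub
  have hue : u * e = e * s * a.1 := by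
    rw [hu, sub_mul, one_mul, sub_mul, he.eq, mul_assoc _ _ e, hae, sub_sub_cancel]
  refine ⟨⟨e * (↑u⁻¹ * (e * s)) * e, _, rfl⟩, Subtype.ext ?_⟩
  change e * (↑u⁻¹ * (e * s)) * e * a.1 = e
  rw [mul_assoc _ e, hea, mul_assoc, mul_assoc, ← hue, ← mul_assoc (↑u⁻¹ : Q), u.inv_mul, one_mul,
    he.eq]

/-- A ring with a complete family of orthogonal idempotents, divided into blocks of equivalent
idempotents such that there are no nonzero elements between different blocks, is a product of
matrix rings over the corners. -/
lemma nonempty_ringEquiv_pi_matrix_corner {n : ℕ} {d : Fin n → ℕ} {e : (Σ i, Fin (d i)) → Q}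
    (he : CompleteOrthogonalIdempotents e)
    (hblock : ∀ p q : Σ i, Fin (d i), p.1 ≠ q.1 → ∀ r, e p * r * e q = 0)
    {e₀ : Fin n → Q} (he₀ : ∀ i, IsIdempotentElem (e₀ i)) {x y : (Σ i, Fin (d i)) → Q}
    (hxy : ∀ p, x p * y p = e₀ p.1) (hyx : ∀ p, y p * x p = e p)
    (hxe : ∀ p, x p * e p = x p) (hey : ∀ p, e p * y p = y p) :
    Nonempty (Q ≃+* ∀ i, Matrix (Fin (d i)) (Fin (d i)) (he₀ i).Corner) := by
  have hex : ∀ p, e₀ p.1 * x p = x p := fun p ↦ by rw [← hxy, mul_assoc, hyx, hxe]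
  have hye : ∀ p, y p * e₀ p.1 = y p := fun p ↦ by rw [← hxy, ← mul_assoc, hyx, hey]
  have hxy0 : ∀ p q, p ≠ q → x p * y q = 0 := fun p q hpq ↦ by
    rw [← hxe, ← hey, mul_assoc, ← mul_assoc (e p), he.ortho hpq, zero_mul, mul_zero]
  have hmem : ∀ i a b r, x ⟨i, a⟩ * r * y ⟨i, b⟩ ∈ Subsemigroup.corner (e₀ i) := fun i a b r ↦ by
    refine (Subsemigroup.mem_corner_iff (he₀ i)).mpr ⟨?_, ?_⟩
    · rw [← mul_assoc, ← mul_assoc, hex ⟨i, a⟩]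
    · rw [mul_assoc, hye ⟨i, b⟩]
  have hcross : ∀ p q : Σ i, Fin (d i), p.1 ≠ q.1 → ∀ r, x p * r * e q = 0 := fun p q hpq r ↦ by
    rw [← hxe, mul_assoc, mul_assoc, ← mul_assoc (e p), hblock p q hpq, mul_zero]
  have hval : ∀ i (s : Finset (Fin (d i))) (t : Fin (d i) → (he₀ i).Corner),
      (∑ b ∈ s, t b).1 = ∑ b ∈ s, (t b).1 := fun i s t ↦
    map_sum (NonUnitalRing.corner (e₀ i)).toAddSubgroup.subtype t s
  -- The matrix entries are the Peirce components of `r`, transported to the corner of `e₀ i` by `x`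
  -- and `y`. Multiplicativity inserts `1 = ∑ p, e p`, where only the terms of block `i` survive.
  let F : Q →+* ∀ i, Matrix (Fin (d i)) (Fin (d i)) (he₀ i).Corner :=
    { toFun r i := Matrix.of fun a b ↦ ⟨x ⟨i, a⟩ * r * y ⟨i, b⟩, hmem i a b r⟩
      map_one' := by
        ext i a b
        apply Subtype.ext
        by_cases hab : a = b
        · subst hab
          simp only [mul_one, Pi.one_apply, Matrix.one_apply_eq]
          exact hxy ⟨i, a⟩
        · simp only [mul_one, Pi.one_apply, Matrix.one_apply_ne hab]
          exact hxy0 _ _ (by simpa using hab)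
      map_mul' r s := by
        ext i a b
        apply Subtype.ext
        rw [Pi.mul_apply, Matrix.mul_apply, hval]
        change x ⟨i, a⟩ * (r * s) * y ⟨i, b⟩ =
          ∑ c, (x ⟨i, a⟩ * r * y ⟨i, c⟩) * (x ⟨i, c⟩ * s * y ⟨i, b⟩)
        calc x ⟨i, a⟩ * (r * s) * y ⟨i, b⟩
            = x ⟨i, a⟩ * r * (∑ p, e p) * (s * y ⟨i, b⟩) := by
              rw [he.complete, mul_one]; simp only [mul_assoc]
          _ = ∑ j, ∑ c, x ⟨i, a⟩ * r * e ⟨j, c⟩ * (s * y ⟨i, b⟩) := by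
              rw [Finset.mul_sum, Finset.sum_mul, Fintype.sum_sigma]
          _ = ∑ c, x ⟨i, a⟩ * r * e ⟨i, c⟩ * (s * y ⟨i, b⟩) :=
              Finset.sum_eq_single i (fun j _ hj ↦ Finset.sum_eq_zero fun c _ ↦ by
                rw [hcross ⟨i, a⟩ ⟨j, c⟩ hj.symm, zero_mul]) (by simp)
          _ = _ := Finset.sum_congr rfl fun c _ ↦ by rw [← hyx]; simp only [mul_assoc]
      map_zero' := by
        ext i a b
        exact Subtype.ext (by simp only [mul_zero, zero_mul]; rfl)
      map_add' r s := by
        ext i a b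
        exact Subtype.ext (by simp only [mul_add, add_mul]; rfl) }
  refine ⟨RingEquiv.ofBijective F ⟨(injective_iff_map_eq_zero F).mpr fun r hr ↦ ?_, fun m ↦ ?_⟩⟩
  · have hpq : ∀ p q, e p * r * e q = 0 := by
      rintro ⟨i, a⟩ ⟨j, b⟩
      by_cases hij : i = j
      · subst hij
        have h0 : x ⟨i, a⟩ * r * y ⟨i, b⟩ = 0 := congrArg Subtype.val (congrFun₂ (congrFun hr i) a b)
        calc e ⟨i, a⟩ * r * e ⟨i, b⟩
            = y ⟨i, a⟩ * (x ⟨i, a⟩ * r * y ⟨i, b⟩) * x ⟨i, b⟩ := by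
              rw [← hyx, ← hyx]; simp only [mul_assoc]
          _ = 0 := by rw [h0, mul_zero, zero_mul]
      · exact hblock _ _ hij r
    calc r = (∑ p, e p) * r * ∑ q, e q := by rw [he.complete, one_mul, mul_one]
      _ = 0 := by
        rw [Finset.sum_mul, Finset.sum_mul]
        refine Finset.sum_eq_zero fun p _ ↦ ?_
        rw [Finset.mul_sum]
        exact Finset.sum_eq_zero fun q _ ↦ hpq p q
  · refine ⟨∑ i, ∑ a, ∑ b, y ⟨i, a⟩ * (m i a b).1 * x ⟨i, b⟩, ?_⟩
    ext i a b
    apply Subtype.ext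
    change x ⟨i, a⟩ * (∑ j, ∑ c, ∑ l, y ⟨j, c⟩ * (m j c l).1 * x ⟨j, l⟩) * y ⟨i, b⟩ = _
    have hterm : ∀ j c l, x ⟨i, a⟩ * (y ⟨j, c⟩ * (m j c l).1 * x ⟨j, l⟩) * y ⟨i, b⟩ =
        (x ⟨i, a⟩ * y ⟨j, c⟩) * (m j c l).1 * (x ⟨j, l⟩ * y ⟨i, b⟩) := fun j c l ↦ by
      simp only [mul_assoc]
    simp only [Finset.mul_sum, Finset.sum_mul, hterm]
    rw [Finset.sum_eq_single i, Finset.sum_eq_single a, Finset.sum_eq_single b, hxy, hxy]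
    · obtain ⟨h1, h2⟩ := (Subsemigroup.mem_corner_iff (he₀ i)).mp (m i a b).2
      rw [h1, h2]
    · intro l _ hl
      rw [hxy0 ⟨i, l⟩ ⟨i, b⟩ (by simpa using hl), mul_zero]
    · simp
    · intro c _ hc
      refine Finset.sum_eq_zero fun l _ ↦ ?_
      rw [hxy0 ⟨i, a⟩ ⟨i, c⟩ (by simpa using hc.symm), zero_mul, zero_mul]
    · simp
    · intro j _ hj
      refine Finset.sum_eq_zero fun c _ ↦ Finset.sum_eq_zero fun l _ ↦ ?_
      rw [hxy0 ⟨i, a⟩ ⟨j, c⟩ fun h ↦ hj (congrArg Sigma.fst h).symm, zero_mul, zero_mul]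
    · simp

end Idempotents

/-! ### Vanishing of Ext and the block decomposition -/

section Blocks

variable {Q : Type u} [Ring Q]

lemma Submodule.exists_retraction_of_isSemisimpleModule {N : Type*} [AddCommGroup N] [Module Q N]
    [IsSemisimpleModule Q N] (T : Submodule Q N) :
    ∃ π : N →ₗ[Q] T, π ∘ₗ T.subtype = LinearMap.id :=
  IsSemisimpleModule.extension_property _ T.injective_subtype _

/-- If `J` lies in `J ^ 2` between different blocks of idempotents, then so does `J ^ (m + 1)` in
`J ^ (m + 2)`. -/
lemma mul_mul_mem_pow_of_mem_sq {J : Ideal Q} [J.IsTwoSided] {ι κ : Type*} [Fintype ι] {e : ι → Q}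
    (he : CompleteOrthogonalIdempotents e) (b : ι → κ)
    (h : ∀ p q, b p ≠ b q → ∀ x ∈ J, e p * x * e q ∈ J ^ 2) (m : ℕ) :
    ∀ p q, b p ≠ b q → ∀ x ∈ J ^ (m + 1), e p * x * e q ∈ J ^ (m + 2) := by
  induction m with
  | zero =>
    intro p q hpq x hx
    rw [zero_add, Submodule.pow_one] at hx
    exact h p q hpq x hx
  | succ m ih =>
    intro p q hpq x hx
    rw [Ideal.IsTwoSided.pow_succ] at hx
    refine Submodule.smul_induction_on hx (fun y hy z hz ↦ ?_) fun y z hy hz ↦ ?_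
    · have hsum : e p * (y • z) * e q = ∑ k, (e p * y * e k) * (e k * z * e q) := by
        calc e p * (y • z) * e q = e p * y * (∑ k, e k) * (z * e q) := by
              rw [he.complete, mul_one, smul_eq_mul]; simp only [mul_assoc]
          _ = _ := by
              rw [Finset.mul_sum, Finset.sum_mul]
              refine Finset.sum_congr rfl fun k _ ↦ ?_
              rw [← (he.idem k).eq]
              simp only [mul_assoc, (he.idem k).eq]
              rw [← mul_assoc (e k) (e k), (he.idem k).eq]
      rw [hsum]
      refine sum_mem fun k _ ↦ ?_
      by_cases hk : b p = b k
      · have h1 : e p * y * e k ∈ J := Ideal.mul_mem_right _ _ (J.mul_mem_left _ hy)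
        have h2 := ih k q (hk ▸ hpq) z hz
        rw [show m + 1 + 2 = (m + 2) + 1 by ring, Ideal.IsTwoSided.pow_succ]
        exact Ideal.mul_mem_mul h1 h2
      · have h1 := h p k hk y hy
        have h2 : e k * z * e q ∈ J ^ (m + 1) :=
          Ideal.mul_mem_right _ _ (Ideal.mul_mem_left _ _ hz)
        rw [show m + 1 + 2 = 2 + (m + 1) by ring, Ideal.IsTwoSided.pow_add]
        exact Ideal.mul_mem_mul h1 h2
    · rw [mul_add, add_mul]
      exact add_mem hy hz

variable [IsSemiprimaryRing Q]

/-- If there are no extensions between nonisomorphic simple modules, then an element of the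
radical lying between inequivalent primitive idempotents lies in the square of the radical. -/
lemma mem_jacobson_sq_of_ext
    (hext : ∀ S T : ModuleCat.{u} Q, IsSimpleModule Q S → IsSimpleModule Q T →
      IsEmpty (S ≃ₗ[Q] T) → ¬ Nontrivial (Abelian.Ext.{u} S T 1))
    {e e' x : Q} (he : IsIdempotentElem e) (heJ : e ∉ Ring.jacobson Q)
    (h : ∀ r, r * e ∉ Ring.jacobson Q → ∃ s, s * (r * e) - e ∈ Ring.jacobson Q)
    (h' : ∀ r, r * e' ∉ Ring.jacobson Q → ∃ s, s * (r * e') - e' ∈ Ring.jacobson Q)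
    (hee' : ∀ r, e * r * e' ∈ Ring.jacobson Q) (hx : x ∈ Ring.jacobson Q) (hxe : x * e = x)
    (hex : e' * x = x) : x ∈ Ring.jacobson Q * Ring.jacobson Q := by
  by_contra hx2
  let J := Ring.jacobson Q
  -- `Q ⧸ K` is `Q e / J e`, presented as a quotient of the free module `Q`.
  let K : Submodule Q Q := Submodule.comap (LinearMap.toSpanSingleton Q Q e) J
  have hK : ∀ r, r ∈ K ↔ r * e ∈ J := fun r ↦ Iff.rfl
  have hS : IsSimpleModule Q (Q ⧸ K) := by
    rw [isSimpleModule_iff_toSpanSingleton_surjective]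
    refine ⟨Submodule.Quotient.nontrivial_iff.mpr fun hK1 ↦ heJ ?_, fun m hm m' ↦ ?_⟩
    · have : (1 : Q) ∈ K := hK1 ▸ Submodule.mem_top
      rwa [hK, one_mul] at this
    · obtain ⟨r, rfl⟩ := K.mkQ_surjective m
      obtain ⟨q, rfl⟩ := K.mkQ_surjective m'
      obtain ⟨s, hs⟩ := h r fun hr ↦ hm ((Submodule.Quotient.mk_eq_zero K).mpr hr)
      refine ⟨q * s, (Submodule.Quotient.eq K).mpr ?_⟩
      rw [hK]
      change (q * s * r - q) * e ∈ J
      rw [sub_mul]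
      have := J.mul_mem_left q hs
      rwa [mul_sub, ← mul_assoc, ← mul_assoc] at this
  let L : Submodule Q Q := (J * J : Ideal Q)
  let N : Submodule Q (Q ⧸ L) := Submodule.map (Submodule.mkQ L) J
  have hN : IsSemisimpleModule Q N := by
    refine isSemisimpleModule_of_jacobson_smul_eq_zero fun r hr m ↦ Subtype.ext ?_
    obtain ⟨_, y, hy, rfl⟩ := m
    exact (Submodule.Quotient.mk_eq_zero L).mpr (Ideal.mul_mem_mul hr hy)
  let ξ : N := ⟨Submodule.mkQ L x, x, hx, rfl⟩
  have hξ : ∀ q : Q, q • ξ = 0 ↔ q * x ∈ L := fun q ↦ by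
    rw [← Submodule.Quotient.mk_eq_zero L, ← Subtype.coe_inj]
    rfl
  -- The class of `x` in `J / J ^ 2` generates a quotient of `Q e' / J e'`, hence a simple module.
  -- It is killed by `e` because `e * Q * e' ⊆ J`, whereas `Q ⧸ K` is not.
  let T : Submodule Q N := Submodule.span Q {ξ}
  let ξ' : T := ⟨ξ, Submodule.mem_span_singleton_self ξ⟩
  have hT' : ∀ t : T, ∃ q : Q, t = q • ξ' := fun t ↦ by
    obtain ⟨q, hq⟩ := Submodule.mem_span_singleton.mp t.2
    exact ⟨q, Subtype.ext hq.symm⟩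
  have hξ' : ∀ q : Q, q • ξ' = 0 ↔ q * x ∈ L := fun q ↦ by
    rw [← hξ, ← Subtype.coe_inj]
    rfl
  have hT : IsSimpleModule Q T := by
    rw [isSimpleModule_iff_toSpanSingleton_surjective]
    refine ⟨⟨ξ', 0, fun h0 ↦ hx2 ?_⟩, fun t ht t' ↦ ?_⟩
    · rw [← one_smul Q ξ', hξ', one_mul] at h0
      exact h0
    · obtain ⟨q, rfl⟩ := hT' t
      obtain ⟨q', rfl⟩ := hT' t'
      rw [Ne, hξ', ← hex, ← mul_assoc] at ht
      obtain ⟨s, hs⟩ := h' q fun hq ↦ ht (Ideal.mul_mem_mul hq hx)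
      refine ⟨q' * s, ?_⟩
      have hmem : (q' * s * q - q') * x ∈ L := ?_
      · rw [LinearMap.toSpanSingleton_apply, ← mul_smul]
        exact sub_eq_zero.mp ((sub_smul _ _ ξ').symm.trans ((hξ' _).mpr hmem))
      have := Ideal.mul_mem_left L q' (Ideal.mul_mem_mul hs hx)
      rw [sub_mul, hex, mul_assoc, mul_assoc, hex] at this
      rw [sub_mul]
      rwa [mul_sub, ← mul_assoc, ← mul_assoc] at this
  have heT : ∀ t : T, e • t = 0 := fun t ↦ by
    obtain ⟨q, rfl⟩ := hT' t
    rw [← mul_smul, hξ', ← hex, ← mul_assoc]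
    exact Ideal.mul_mem_mul (hee' q) hx
  have hST : IsEmpty ((Q ⧸ K) ≃ₗ[Q] T) := by
    refine ⟨fun E ↦ heJ ?_⟩
    have h0 : E (e • K.mkQ 1) = 0 := by rw [map_smul, heT]
    rw [E.map_eq_zero_iff, ← map_smul] at h0
    have := (Submodule.Quotient.mk_eq_zero K).mp h0
    rwa [hK, smul_eq_mul, mul_one, he.eq] at this
  obtain ⟨π, hπ⟩ := T.exists_retraction_of_isSemisimpleModule
  -- `g` sends `r` to `π` of the class of `r * e`. An extension `l` to `Q` would have `l x = x • e •
  -- l 1 = 0`, although `g` sends `x` to the generator `ξ'`.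
  let g : K →ₗ[Q] T := π ∘ₗ ((Submodule.mkQ L).restrict (p := J) (q := N)
      fun y hy ↦ ⟨y, hy, rfl⟩) ∘ₗ
    ((LinearMap.toSpanSingleton Q Q e).restrict (p := K) (q := J) fun _ hr ↦ hr)
  have : Projective (ModuleCat.of Q Q) :=
    ModuleCat.projective_of_free (Module.Basis.singleton Unit Q)
  have hl : ∃ l : Q →ₗ[Q] T, l ∘ₗ K.subtype = g := by
    by_contra! hne
    exact hext (ModuleCat.of Q (Q ⧸ K)) (ModuleCat.of Q T) hS hT hST
      ((nontrivial_ext_one_iff K.injective_subtype K.mkQ_surjective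
        (LinearMap.exact_subtype_mkQ K)).mpr ⟨g, hne⟩)
  obtain ⟨l, hl⟩ := hl
  have hxK : x ∈ K := by rw [hK, hxe]; exact hx
  have h1 : l x = 0 := by
    rw [← mul_one x, ← smul_eq_mul, map_smul, ← hxe, mul_smul, heT, smul_zero]
  have h2 : l x = ξ' := by
    have h3 : l x = g ⟨x, hxK⟩ := LinearMap.congr_fun hl ⟨x, hxK⟩
    have h4 : g ⟨x, hxK⟩ = π ξ := congrArg π (Subtype.ext (congrArg (Submodule.mkQ L) hxe))
    rw [h3, h4]
    exact LinearMap.congr_fun hπ ξ'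
  rw [h1] at h2
  have := (hξ' 1).mp (by rw [← h2, smul_zero])
  rw [one_mul] at this
  exact hx2 this

/-- A semiprimary ring without extensions between nonisomorphic simple modules is a product of
matrix rings over local rings. -/
lemma isProdMatrixLocal_of_ext
    (hext : ∀ S T : ModuleCat.{u} Q, IsSimpleModule Q S → IsSimpleModule Q T →
      IsEmpty (S ≃ₗ[Q] T) → ¬ Nontrivial (Abelian.Ext.{u} S T 1)) : IsProdMatrixLocal Q := by
  let J := Ring.jacobson Q
  obtain ⟨N, hN⟩ := IsSemiprimaryRing.isNilpotent (R := Q)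
  obtain ⟨n, D, d, _, hd, ⟨ψ⟩⟩ :=
    IsSemisimpleRing.exists_ringEquiv_pi_matrix_divisionRing (Q ⧸ J)
  let f : Q →+* ∀ i, Matrix (Fin (d i)) (Fin (d i)) (D i) := (ψ : _ →+* _).comp (Ideal.Quotient.mk J)
  have hf : Function.Surjective f := ψ.surjective.comp Ideal.Quotient.mk_surjective
  have hfJ : ∀ x, f x = 0 ↔ x ∈ J := fun x ↦
    ψ.map_eq_zero_iff.trans Ideal.Quotient.eq_zero_iff_mem
  have hnil : ∀ x, f x = 0 → IsNilpotent x := fun x hx ↦ ⟨N, by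
    simpa [J, hN] using Ideal.pow_mem_pow ((hfJ x).mp hx) N⟩
  let E (i) (a b : Fin (d i)) (c : D i) : ∀ i, Matrix (Fin (d i)) (Fin (d i)) (D i) :=
    Pi.single i (Matrix.single a b c)
  have hE : ∀ i a b c b' c', E i a b c * E i b b' c' = E i a b' (c * c') := fun i a b c b' c' ↦ by
    rw [← Pi.single_mul, Matrix.single_mul_single_same]
  have hE_idem : CompleteOrthogonalIdempotents fun p : Σ i, Fin (d i) ↦ E p.1 p.2 p.2 1 := by
    refine ⟨⟨fun p ↦ by rw [IsIdempotentElem, hE, mul_one], ?_⟩, ?_⟩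
    · rintro ⟨i, a⟩ ⟨j, b⟩ hab
      by_cases hij : i = j
      · subst hij
        change E i a a 1 * E i b b 1 = 0
        rw [← Pi.single_mul, Matrix.single_mul_single_of_ne, Pi.single_zero]
        simpa using hab
      · ext l : 1
        by_cases hl : l = i
        · subst hl; simp [E, hij]
        · simp [E, hl]
    · rw [Fintype.sum_sigma]
      ext i : 1
      rw [Finset.sum_apply, Finset.sum_eq_single i]
      · rw [Finset.sum_apply]
        simp only [E, Pi.single_eq_same, Pi.one_apply]
        exact Matrix.sum_single_one
      · intro j _ hj
        rw [Finset.sum_apply]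
        exact Finset.sum_eq_zero fun a _ ↦ by simp [E, hj.symm]
      · simp
  obtain ⟨e, he, hfe⟩ := CompleteOrthogonalIdempotents.lift_of_isNilpotent_ker f hnil hE_idem
    fun p ↦ hf _
  replace hfe : ∀ p, f (e p) = E p.1 p.2 p.2 1 := fun p ↦ congrFun hfe p
  have hfe0 : ∀ p, f (e p) ≠ 0 := fun p h0 ↦ by
    have := congrFun₂ (congrFun ((hfe p).symm.trans h0) p.1) p.2 p.2
    simp [E] at this
  have hprim : ∀ p r, f (r * e p) ≠ 0 → ∃ s, f (s * (r * e p)) = f (e p) := by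
    rintro ⟨i, a⟩ r hr
    obtain ⟨b, hb⟩ : ∃ b, f r i b a ≠ 0 := by
      by_contra! hb
      apply hr
      rw [map_mul, hfe]
      ext j : 1
      by_cases hj : j = i
      · subst hj
        ext c c'
        by_cases hc : c' = a
        · subst hc; simp [E, hb]
        · simp [E, hc]
      · simp [E, hj]
    -- Multiplying by this matrix unit moves row `b` to row `a` and normalises the pivot entry to
    -- `1`, leaving the diagonal matrix unit.
    obtain ⟨s, hs⟩ := hf (E i a b (f r i b a)⁻¹)
    refine ⟨s, ?_⟩
    rw [map_mul, map_mul, hs, hfe]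
    ext j : 1
    by_cases hj : j = i
    · subst hj
      simp [E, ← mul_assoc, hb]
    · simp [E, hj]
  have hcross : ∀ p q : Σ i, Fin (d i), p.1 ≠ q.1 → ∀ r, e p * r * e q ∈ J := by
    rintro ⟨i, a⟩ ⟨j, b⟩ hij r
    rw [← hfJ, map_mul, map_mul, hfe, hfe]
    ext l : 1
    by_cases hl : l = i
    · subst hl; simp [E, show l ≠ j from hij]
    · simp [E, hl]
  have hprimJ : ∀ p r, r * e p ∉ J → ∃ s, s * (r * e p) - e p ∈ J := fun p r hr ↦ by
    obtain ⟨s, hs⟩ := hprim p r (mt (hfJ _).mp hr)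
    exact ⟨s, (hfJ _).mp (by rw [map_sub, hs, sub_self])⟩
  have hsq : ∀ p q : Σ i, Fin (d i), p.1 ≠ q.1 → ∀ x ∈ J, e p * x * e q ∈ J ^ 2 := by
    intro p q hpq x hx
    rw [Submodule.pow_succ, Submodule.pow_one]
    refine mem_jacobson_sq_of_ext hext (e := e q) (e' := e p) (he.idem q)
      (mt (hfJ _).mpr (hfe0 q)) (hprimJ q) (hprimJ p) (fun r ↦ hcross q p hpq.symm r)
      (Ideal.mul_mem_right _ _ (J.mul_mem_left _ hx)) ?_ ?_
    · rw [mul_assoc, (he.idem q).eq]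
    · rw [← mul_assoc, ← mul_assoc, (he.idem p).eq]
  have hblock : ∀ p q : Σ i, Fin (d i), p.1 ≠ q.1 → ∀ r, e p * r * e q = 0 := by
    intro p q hpq r
    -- The element is unchanged when multiplied by `e p` and `e q` again, so it climbs through all
    -- powers of `J`.
    have hpow : ∀ m, e p * r * e q ∈ J ^ (m + 1) := by
      intro m
      induction m with
      | zero => rw [zero_add, Submodule.pow_one]; exact hcross p q hpq r
      | succ m ih =>
        have := mul_mul_mem_pow_of_mem_sq he Sigma.fst hsq m p q hpq _ ih
        rwa [mul_assoc, mul_assoc, (he.idem q).eq, ← mul_assoc, ← mul_assoc,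
          (he.idem p).eq] at this
    have := Ideal.pow_le_pow_right N.le_succ (hpow N)
    rwa [hN] at this
  let z (i) : Fin (d i) := ⟨0, Nat.pos_of_ne_zero (hd i).out⟩
  have hxy : ∀ p : Σ i, Fin (d i), ∃ x y, x * y = e ⟨p.1, z p.1⟩ ∧ y * x = e p ∧ x * e p = x ∧
      e p * y = y := by
    rintro ⟨i, a⟩
    obtain ⟨x, hx⟩ := hf (E i (z i) a 1)
    obtain ⟨y, hy⟩ := hf (E i a (z i) 1)
    exact exists_mul_eq_and_mul_eq_of_map f hnil (he.idem _) (he.idem _) (x := x) (y := y)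
      (by rw [hx, hy, hE, hfe, mul_one]) (by rw [hx, hy, hE, hfe, mul_one])
  choose x y hxy hyx hxe hey using hxy
  exact ⟨n, d, fun i ↦ (he.idem ⟨i, z i⟩).Corner, inferInstance,
    fun i ↦ Nat.pos_of_ne_zero (hd i).out,
    fun i ↦ isLocalRing_corner f hnil _ (hfe0 _) (hprim _),
    nonempty_ringEquiv_pi_matrix_corner he hblock (fun i ↦ he.idem ⟨i, z i⟩) hxy hyx hxe hey⟩

end Blocks

/-! ### The equivalence -/

theorem theorem2 (R : Type u) [Ring R] [IsSemiprimaryRing R] :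
    List.TFAE [
      HasCSL (FinLen R),
      (rightGabrielQuiver R).TotallyDisconnected,
      IsProdMatrixLocal R,
      HasCSL (AllMod R)] := by
  tfae_have 4 → 1 := fun h M _ hM ↦ h M trivial hM
  tfae_have 1 → 2 := by
    rintro h i j hij ⟨S, T, rfl, rfl, hST⟩
    have := S.2
    have := T.2
    exact subsingleton_ext_one_of_csl h S.1 T.1
      ⟨fun E ↦ hij (Quotient.sound (s := simpleIsoSetoid R) ⟨E⟩)⟩ hST
  tfae_have 2 → 3 := by
    intro h
    rw [← isProdMatrixLocal_mulOpposite_iff]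
    refine isProdMatrixLocal_of_ext fun S T hS hT hST hnt ↦ ?_
    refine h (.mk ⟨S, hS⟩) (.mk ⟨T, hT⟩) (fun heq ↦ ?_) ⟨⟨S, hS⟩, ⟨T, hT⟩, rfl, rfl, hnt⟩
    obtain ⟨E⟩ := Quotient.exact (s := simpleIsoSetoid R) heq
    exact hST.false E
  tfae_have 3 → 4 := fun h M _ hM ↦ isSimpleModule_of_isDivRing_end h.mulOpposite hM
  tfae_finish
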